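/- Let $\Sigma=\{a,b\}$. A finite word $w$ over $\Sigma$ is called Sturmian if it is balanced, that is, if for any two factors $u,v$ of $w$ of the same length, the numbers of occurrences of the letter $a$ in $u$ and in $v$ differ by at most $1$. A Sturmian word $w$ is bispecial if $aw$, $bw$, $wa$ and $wb$ are all Sturmian; a bispecial Sturmian word $w$ is strictly bispecial if $awa$, $awb$, $bwa$ and $bwb$ are all Sturmian, and non-strictly bispecial otherwise. Let $\phi$ denote Euler's totient function. For every integer $n>1$, the number of non-strictly bispecial Sturmian words of length $n$ is exactly $2\bigl(n+1-\phi(n+2)\bigr)$. -/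

import Mathlib

/-- The two-letter alphabet `Σ = {a, b}`. -/
inductive Letter where
  | a : Letter
  | b : Letter
  deriving DecidableEq

instance : Fintype Letter where
  elems := {Letter.a, Letter.b}
  complete := fun x => by cases x <;> simp

/-- Finite words over `Σ = {a, b}`. -/
abbrev Word := List Letter

namespace Word

/-- A word is balanced if the numbers of occurrences of the letter `a` in any two of its factors of
the same length differ by at most one (`u <:+: w` says that `u` is a factor of `w`, that is, a block
of consecutive letters). -/
def IsBalanced (w : Word) : Prop :=
  ∀ u v : Word, u <:+: w → v <:+: w → u.length = v.length →
    |(u.count Letter.a : ℤ) - (v.count Letter.a : ℤ)| ≤ 1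

/-- The language `St` of (finite) Sturmian words: the balanced words over `{a, b}`. -/
def St : Set Word := {w | IsBalanced w}

/-- The set `LS` of left special Sturmian words. -/
def LS : Set Word := {w | w ∈ St ∧ Letter.a :: w ∈ St ∧ Letter.b :: w ∈ St}

/-- The set `RS` of right special Sturmian words. -/
def RS : Set Word := {w | w ∈ St ∧ w ++ [Letter.a] ∈ St ∧ w ++ [Letter.b] ∈ St}

/-- The set `BS` of bispecial Sturmian words. -/
def BS : Set Word := LS ∩ RS

/-- The set `SBS` of strictly bispecial Sturmian words: the bispecial Sturmian words `w` such that
`awa`, `awb`, `bwa` and `bwb` are all Sturmian. -/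
def SBS : Set Word := {w | w ∈ BS ∧ ∀ x y : Letter, [x] ++ w ++ [y] ∈ St}

/-- The set `NBS` of non-strictly bispecial Sturmian words: the bispecial Sturmian words that are
not strictly bispecial. -/
def NBS : Set Word := BS \ SBS

/-- The number `X(n)` of words of length `n` in the language `X`. -/
noncomputable def numOfLength (X : Set Word) (n : ℕ) : ℕ :=
  (X ∩ {w | w.length = n}).ncard

/-- The set counted by `numOfLength` is always finite. -/
theorem finite_inter_length_eq (X : Set Word) (n : ℕ) :
    (X ∩ {w | w.length = n}).Finite :=
  (List.finite_length_eq Letter n).subset Set.inter_subset_right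

end Word

namespace Word

/-! Put N = n + 2. A bispecial word w of length n with p - 1 letters `b` is determined by p up to a
sign s: its heights are the integer parts of ((k + 1)p - s)/N with s = 0 or s = 1, where 1 ≤ p ≤ n +
1. Conversely all these words are bispecial (`IsLineWord.mem_BS`). If p is coprime to N, the line of
slope p/N has no interior lattice point, and tilting it slightly yields all four two-sided
extensions (`IsLineWord.mem_SBS`). Otherwise an interior lattice point separates s = 0 from s = 1
and obstructs one extension of each word (`IsLineWord.not_mem_SBS`). So each p not coprime to N
contributes exactly two words. The core is `exists_isLineWord_of_mem_BS`. Bispeciality makes G(k +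
1) = `height w k`, G(0) = 0, superadditive modulo N with gain p per period, and -G - 1 likewise with
gain -p. Iterating N times confines the heights to a closed strip of vertical width 1, and a
Euclidean descent shows that only one edge of the strip is touched. -/

/-! ### Heights and balance. -/

/-- The number of occurrences of `b` in the prefix of length `k` of `w`. -/
def height (w : Word) (k : ℕ) : ℤ := ((w.take k).count Letter.b : ℤ)

/-- The contribution of a letter to the height. -/
def letterVal (x : Letter) : ℤ := if x = Letter.b then 1 else 0

@[simp] theorem letterVal_a : letterVal Letter.a = 0 := rfl

@[simp] theorem letterVal_b : letterVal Letter.b = 1 := rfl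

theorem letterVal_injective : Function.Injective letterVal := by
  intro x y h
  cases x <;> cases y <;> simp_all

@[simp] theorem height_zero (w : Word) : height w 0 = 0 := by simp [height]

theorem height_cons_succ (x : Letter) (w : Word) (k : ℕ) :
    height (x :: w) (k + 1) = letterVal x + height w k := by
  cases x <;> simp [height, letterVal, add_comm]

theorem height_append_of_le (w v : Word) {k : ℕ} (hk : k ≤ w.length) :
    height (w ++ v) k = height w k := by
  simp [height, List.take_append_of_le_length hk]

theorem height_concat_length (w : Word) (y : Letter) :
    height (w ++ [y]) (w.length + 1) = height w w.length + letterVal y := by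
  have : (w ++ [y]).take (w.length + 1) = w ++ [y] := List.take_of_length_le (by simp)
  rw [height, this, height, List.take_length]
  cases y <;> simp [letterVal]

theorem height_succ (w : Word) {k : ℕ} (hk : k < w.length) :
    height w (k + 1) = height w k + letterVal w[k] := by
  rw [height, height, List.take_succ_eq_append_getElem hk, List.count_append]
  cases w[k] <;> simp [letterVal]

theorem height_nonneg (w : Word) (k : ℕ) : 0 ≤ height w k := by simp [height]

theorem height_le (w : Word) (k : ℕ) : height w k ≤ k := by
  have h1 : (w.take k).count Letter.b ≤ (w.take k).length := List.count_le_length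
  have h2 : (w.take k).length ≤ k := List.length_take_le k w
  unfold height
  exact_mod_cast h1.trans h2

theorem eq_of_height_eq {v w : Word} (hl : v.length = w.length)
    (h : ∀ k ≤ w.length, height v k = height w k) : v = w := by
  refine List.ext_getElem hl fun i hv hw => letterVal_injective ?_
  have h1 := height_succ v hv
  have h2 := height_succ w hw
  have h3 := h i hw.le
  have h4 := h (i + 1) hw
  omega

theorem count_a_add_count_b (w : Word) :
    w.count Letter.a + w.count Letter.b = w.length := by
  induction w with
  | nil => simp
  | cons x w ih => cases x <;> simp <;> omega

theorem count_take_drop (w : Word) (i k : ℕ) :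
    (((w.drop i).take k).count Letter.b : ℤ) = height w (i + k) - height w i := by
  rw [height, height, List.take_add, List.count_append]
  push_cast
  ring

/-- Factors of equal length have complementary letter counts, so balance in `a` amounts to balance
in `b`. -/
theorem isBalanced_iff_height (w : Word) :
    IsBalanced w ↔ ∀ i j k : ℕ, i + k ≤ w.length → j + k ≤ w.length →
      |(height w (i + k) - height w i) - (height w (j + k) - height w j)| ≤ 1 := by
  constructor
  · intro h i j k hi hj
    have hinf : ∀ i, (w.drop i).take k <:+: w := fun i =>
      (List.take_prefix _ _).isInfix.trans (List.drop_suffix _ _).isInfix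
    have hlen : ∀ i, i + k ≤ w.length → ((w.drop i).take k).length = k := by
      intro i hi
      simp only [List.length_take, List.length_drop]
      omega
    have := h _ _ (hinf i) (hinf j) ((hlen i hi).trans (hlen j hj).symm)
    have e1 := count_a_add_count_b ((w.drop i).take k)
    have e2 := count_a_add_count_b ((w.drop j).take k)
    rw [hlen i hi] at e1
    rw [hlen j hj] at e2
    rw [← count_take_drop, ← count_take_drop]
    rw [abs_le] at this ⊢
    omega
  · intro h u v hu hv huv
    have key : ∀ u : Word, u <:+: w → ∃ i, i + u.length ≤ w.length ∧
        (u.count Letter.b : ℤ) = height w (i + u.length) - height w i := by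
      rintro u ⟨s, t, rfl⟩
      refine ⟨s.length, by simp, ?_⟩
      rw [← count_take_drop]
      simp
    obtain ⟨i, hi, ei⟩ := key u hu
    obtain ⟨j, hj, ej⟩ := key v hv
    have := h i j u.length hi (by omega)
    rw [huv, ← ej, ← huv, ← ei] at this
    have e1 := count_a_add_count_b u
    have e2 := count_a_add_count_b v
    rw [abs_le] at this ⊢
    omega

/-- A word whose heights are the integer parts of the points of a line is balanced. -/
theorem isBalanced_of_line (w : Word) (A B C : ℤ) (hC : 0 < C)
    (h : ∀ k : ℕ, k ≤ w.length →
      C * height w k ≤ A * k + B ∧ A * k + B < C * height w k + C) : IsBalanced w := by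
  rw [isBalanced_iff_height]
  intro i j k hi hj
  obtain ⟨a1, a2⟩ := h i (by omega)
  obtain ⟨b1, b2⟩ := h (i + k) hi
  obtain ⟨c1, c2⟩ := h j (by omega)
  obtain ⟨d1, d2⟩ := h (j + k) hj
  push_cast at b1 b2 d1 d2
  have e1 : C * (height w (i + k) - height w i - (height w (j + k) - height w j)) < C * 2 := by
    linarith
  have e2 : C * (-2) < C * (height w (i + k) - height w i - (height w (j + k) - height w j)) := by
    linarith
  have f1 := lt_of_mul_lt_mul_left e1 hC.le
  have f2 := lt_of_mul_lt_mul_left e2 hC.le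
  rw [abs_le]
  omega

/-! ### Words following a line. -/

/-- `w` has length `n`, and its heights follow the line of slope `p / (n + 2)` from below, weakly
if `s = 0` and strictly if `s = 1`. For `s = 0` this says that `awb` is a power of a lower
Christoffel word, for `s = 1` that `bwa` is a power of an upper Christoffel word. -/
structure IsLineWord (n : ℕ) (p s : ℤ) (w : Word) : Prop where
  length_eq : w.length = n
  le : ∀ k : ℕ, k ≤ n → ((n : ℤ) + 2) * height w k ≤ (k + 1) * p - s
  lt : ∀ k : ℕ, k ≤ n → (k + 1) * p - s < ((n : ℤ) + 2) * height w k + (n + 2)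

theorem IsLineWord.eq {n : ℕ} {p s : ℤ} {v w : Word} (hv : IsLineWord n p s v)
    (hw : IsLineWord n p s w) : v = w := by
  refine eq_of_height_eq (hv.length_eq.trans hw.length_eq.symm) fun k hk => ?_
  rw [hw.length_eq] at hk
  have hN : (0 : ℤ) ≤ (n : ℤ) + 2 := by positivity
  have h1 := hv.le k hk
  have h2 := hv.lt k hk
  have h3 := hw.le k hk
  have h4 := hw.lt k hk
  have e1 : ((n : ℤ) + 2) * height v k < ((n : ℤ) + 2) * (height w k + 1) := by linarith
  have e2 : ((n : ℤ) + 2) * height w k < ((n : ℤ) + 2) * (height v k + 1) := by linarith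
  have f1 := lt_of_mul_lt_mul_left e1 hN
  have f2 := lt_of_mul_lt_mul_left e2 hN
  omega

/-- The word of length `n` following the line of slope `p / (n + 2)`. -/
def lineWord (n : ℕ) (p s : ℤ) : Word :=
  (List.range n).map fun i : ℕ =>
    if (((i : ℤ) + 2) * p - s) / ((n : ℤ) + 2) = (((i : ℤ) + 1) * p - s) / ((n : ℤ) + 2)
    then Letter.a else Letter.b

theorem isLineWord_lineWord (n : ℕ) {p s : ℤ} (hp : 1 ≤ p) (hpn : p ≤ n + 1) (hs : 0 ≤ s)
    (hs1 : s ≤ 1) : IsLineWord n p s (lineWord n p s) := by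
  have hN : (0 : ℤ) < (n : ℤ) + 2 := by positivity
  have hlen : (lineWord n p s).length = n := by simp [lineWord]
  have key : ∀ k : ℕ, k ≤ n →
      height (lineWord n p s) k = (((k : ℤ) + 1) * p - s) / ((n : ℤ) + 2) := by
    intro k
    induction k with
    | zero =>
      intro _
      rw [height_zero, eq_comm]
      apply Int.ediv_eq_zero_of_lt <;> push_cast <;> linarith
    | succ k ih =>
      intro hk
      rw [height_succ _ (by omega), ih (by omega)]
      simp only [lineWord, List.getElem_map, List.getElem_range]
      push_cast
      have e : ((k : ℤ) + 1 + 1) = k + 2 := by ring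
      rw [e]
      split_ifs with hc
      · rw [hc]; simp
      · have h1 : (((k : ℤ) + 1) * p - s) / ((n : ℤ) + 2) ≤
            (((k : ℤ) + 2) * p - s) / ((n : ℤ) + 2) :=
          Int.ediv_le_ediv hN (by linarith)
        have h2 : (((k : ℤ) + 2) * p - s) / ((n : ℤ) + 2) ≤
            (((k : ℤ) + 1) * p - s + 1 * ((n : ℤ) + 2)) / ((n : ℤ) + 2) :=
          Int.ediv_le_ediv hN (by linarith)
        rw [Int.add_mul_ediv_right _ _ hN.ne'] at h2
        simp only [letterVal_b]
        omega
  refine ⟨hlen, fun k hk => ?_, fun k hk => ?_⟩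
  · rw [key k hk]
    exact Int.mul_ediv_self_le hN.ne'
  · rw [key k hk]
    exact Int.lt_mul_ediv_self_add hN

/-! ### Line words are bispecial. -/

theorem isBalanced_cons_of_line {n : ℕ} {w : Word} (hn : w.length = n) (x : Letter) (A B C : ℤ)
    (hC : 0 < C) (hB : 0 ≤ B) (hBC : B < C)
    (h : ∀ k : ℕ, k ≤ n → C * (letterVal x + height w k) ≤ A * (k + 1) + B ∧
      A * (k + 1) + B < C * (letterVal x + height w k) + C) : IsBalanced (x :: w) := by
  refine isBalanced_of_line _ A B C hC fun k hk => ?_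
  cases k with
  | zero => simpa using ⟨hB, hBC⟩
  | succ k =>
    rw [height_cons_succ]
    push_cast
    exact h k (by simp at hk; omega)

theorem isBalanced_concat_of_line {n : ℕ} {w : Word} (hn : w.length = n) (y : Letter)
    (A B C : ℤ) (hC : 0 < C)
    (h : ∀ k : ℕ, k ≤ n → C * height w k ≤ A * k + B ∧ A * k + B < C * height w k + C)
    (hl : C * (height w n + letterVal y) ≤ A * (n + 1) + B)
    (hr : A * (n + 1) + B < C * (height w n + letterVal y) + C) : IsBalanced (w ++ [y]) := by
  refine isBalanced_of_line _ A B C hC fun k hk => ?_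
  rcases Nat.lt_or_ge n k with hkn | hkn
  · obtain rfl : k = n + 1 := by simp at hk; omega
    subst hn
    rw [height_concat_length]
    push_cast
    exact ⟨hl, hr⟩
  · rw [height_append_of_le _ _ (by omega)]
    exact h k hkn

theorem IsLineWord.height_length {n : ℕ} {p s : ℤ} {w : Word} (h : IsLineWord n p s w)
    (hp : 1 ≤ p) (hpn : p ≤ n + 1) (hs : 0 ≤ s) (hs1 : s ≤ 1) : height w n = p - 1 := by
  have hN : (0 : ℤ) ≤ (n : ℤ) + 2 := by positivity
  have h1 := h.le n le_rfl
  have h2 := h.lt n le_rfl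
  have e1 : ((n : ℤ) + 2) * height w n < ((n : ℤ) + 2) * p := by linarith
  have e2 : ((n : ℤ) + 2) * (p - 1) < ((n : ℤ) + 2) * (height w n + 1) := by linarith
  have f1 := lt_of_mul_lt_mul_left e1 hN
  have f2 := lt_of_mul_lt_mul_left e2 hN
  omega

theorem IsLineWord.mem_BS {n : ℕ} {p s : ℤ} {w : Word} (h : IsLineWord n p s w)
    (hp : 1 ≤ p) (hpn : p ≤ n + 1) (hs : s = 0 ∨ s = 1) : w ∈ BS := by
  have hN : (0 : ℤ) < (n : ℤ) + 2 := by positivity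
  have hN2 : (0 : ℤ) < ((n : ℤ) + 2) ^ 2 := by positivity
  have hend : height w n = p - 1 := h.height_length hp hpn (by omega) (by omega)
  have hw : w ∈ St := by
    refine isBalanced_of_line w p (p - s) (n + 2) hN fun k hk => ?_
    rw [h.length_eq] at hk
    have h1 := h.le k hk
    have h2 := h.lt k hk
    constructor <;> linarith
  -- Integrality leaves a gap of n + 2 after scaling by n + 2; this is the room for changing the
  -- slope by 1/(n + 2)².
  have haux : ∀ k : ℕ, k ≤ n →
      ((n : ℤ) + 2) ^ 2 * height w k ≤ (n + 2) * ((k + 1) * p - s) ∧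
      (n + 2) * ((k + 1) * p - s) + (n + 2) ≤
        ((n : ℤ) + 2) ^ 2 * height w k + (n + 2) ^ 2 := by
    intro k hk
    have h1 := mul_le_mul_of_nonneg_left (h.le k hk) hN.le
    have h2 := mul_le_mul_of_nonneg_left (Int.add_one_le_iff.2 (h.lt k hk)) hN.le
    constructor <;> linarith
  have hcons : ∀ x, IsBalanced (x :: w) := by
    intro x
    rcases hs with rfl | rfl <;> cases x
    · refine isBalanced_cons_of_line h.length_eq _ p 0 (n + 2) hN le_rfl hN fun k hk => ?_
      have h1 := h.le k hk
      have h2 := h.lt k hk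
      simp only [letterVal_a]
      constructor <;> linarith
    -- The line starts just below 1, so that the first letter can be `b`; the raised slope regains
    -- the lattice points at once, and its total drift stays within the gap.
    · refine isBalanced_cons_of_line h.length_eq _ ((n + 2) * p + 1) ((n + 2) ^ 2 - 1)
        ((n + 2) ^ 2) hN2 (by linarith) (by linarith) fun k hk => ?_
      obtain ⟨h1, h2⟩ := haux k hk
      have : (k : ℤ) ≤ n := by exact_mod_cast hk
      simp only [letterVal_b]
      constructor <;> linarith
    · refine isBalanced_cons_of_line h.length_eq _ ((n + 2) * p - 1) 0
        ((n + 2) ^ 2) hN2 le_rfl hN2 fun k hk => ?_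
      obtain ⟨h1, h2⟩ := haux k hk
      have : (k : ℤ) ≤ n := by exact_mod_cast hk
      simp only [letterVal_a]
      constructor <;> linarith
    · refine isBalanced_cons_of_line h.length_eq _ p (n + 1) (n + 2) hN (by positivity)
        (by linarith) fun k hk => ?_
      have h1 := h.le k hk
      have h2 := h.lt k hk
      simp only [letterVal_b]
      constructor <;> linarith
  have hconcat : ∀ y, IsBalanced (w ++ [y]) := by
    intro y
    rcases hs with rfl | rfl <;> cases y
    -- The constant term makes the line end just below the integer p, forcing a last letter `a`.
    · refine isBalanced_concat_of_line h.length_eq _ ((n + 2) * p - 1) ((n + 2) * p + n)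
        ((n + 2) ^ 2) hN2 (fun k hk => ?_) ?_ ?_
      · obtain ⟨h1, h2⟩ := haux k hk
        have : (k : ℤ) ≤ n := by exact_mod_cast hk
        constructor <;> linarith
      · rw [hend, letterVal_a]; nlinarith
      · rw [hend, letterVal_a]; nlinarith
    · refine isBalanced_concat_of_line h.length_eq _ p p (n + 2) hN (fun k hk => ?_) ?_ ?_
      · have h1 := h.le k hk
        have h2 := h.lt k hk
        constructor <;> linarith
      · rw [hend, letterVal_b]; linarith
      · rw [hend, letterVal_b]; linarith
    · refine isBalanced_concat_of_line h.length_eq _ p (p - 1) (n + 2) hN (fun k hk => ?_) ?_ ?_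
      · have h1 := h.le k hk
        have h2 := h.lt k hk
        constructor <;> linarith
      · rw [hend, letterVal_a]; linarith
      · rw [hend, letterVal_a]; linarith
    · refine isBalanced_concat_of_line h.length_eq _ ((n + 2) * p + 1) ((n + 2) * p - n - 1)
        ((n + 2) ^ 2) hN2 (fun k hk => ?_) ?_ ?_
      · obtain ⟨h1, h2⟩ := haux k hk
        have : (k : ℤ) ≤ n := by exact_mod_cast hk
        constructor <;> linarith
      · rw [hend, letterVal_b]; nlinarith
      · rw [hend, letterVal_b]; nlinarith
  exact ⟨⟨hw, hcons _, hcons _⟩, ⟨hw, hconcat _, hconcat _⟩⟩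

/-! ### Strictness and coprimality. -/

theorem height_cons_concat_succ {n : ℕ} {w : Word} (hn : w.length = n) (x y : Letter) {k : ℕ}
    (hk : k ≤ n) : height ([x] ++ w ++ [y]) (k + 1) = letterVal x + height w k := by
  rw [height_append_of_le _ _ (by simp; omega)]
  exact height_cons_succ x w k

theorem height_cons_concat_length {n : ℕ} {w : Word} (hn : w.length = n) (x y : Letter) :
    height ([x] ++ w ++ [y]) (n + 2) = letterVal x + height w n + letterVal y := by
  have h := height_concat_length ([x] ++ w) y
  have hl : ([x] ++ w).length = n + 1 := by simp [hn]
  rw [hl] at h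
  rw [h]
  congr 1
  exact height_cons_succ x w n

theorem IsLineWord.mem_SBS {n : ℕ} {p : ℤ} {s : ℤ} {w : Word} (h : IsLineWord n p s w)
    (hp : 1 ≤ p) (hpn : p ≤ n + 1) (hs : s = 0 ∨ s = 1) (hco : IsCoprime p ((n : ℤ) + 2)) :
    w ∈ SBS := by
  refine ⟨h.mem_BS hp hpn hs, fun x y => ?_⟩
  have hN : (0 : ℤ) < (n : ℤ) + 2 := by positivity
  have hN2 : (0 : ℤ) < ((n : ℤ) + 2) ^ 2 := by positivity
  have hend : height w n = p - 1 := h.height_length hp hpn (by omega) (by omega)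
  have hstrict : ∀ k : ℕ, k ≤ n → ((n : ℤ) + 2) * height w k + 1 ≤ (k + 1) * p ∧
      (k + 1) * p + 1 ≤ ((n : ℤ) + 2) * height w k + (n + 2) := by
    intro k hk
    have h1 := h.le k hk
    have h2 := h.lt k hk
    -- By coprimality a lattice point at abscissa k + 1 would force n + 2 to divide k + 1 ≤ n + 1.
    have hne : ∀ m : ℤ, ((n : ℤ) + 2) * m ≠ (k + 1) * p := by
      intro m hm
      have hd : ((n : ℤ) + 2) ∣ ((k + 1 : ℕ) : ℤ) :=
        hco.symm.dvd_of_dvd_mul_right ⟨m, by push_cast; exact hm.symm⟩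
      have := Int.le_of_dvd (by positivity) hd
      push_cast at this
      omega
    have n1 := hne (height w k)
    have n2 := hne (height w k + 1)
    rw [mul_add, mul_one] at n2
    generalize ((n : ℤ) + 2) * height w k = X at *
    generalize ((k : ℤ) + 1) * p = Y at *
    omega
  have line : ∀ (A B C : ℤ), 0 < C → 0 ≤ B → B < C →
      (∀ k : ℕ, k ≤ n → C * (letterVal x + height w k) ≤ A * (k + 1) + B ∧
        A * (k + 1) + B < C * (letterVal x + height w k) + C) →
      C * (letterVal x + (p - 1) + letterVal y) ≤ A * (n + 2) + B →
      A * (n + 2) + B < C * (letterVal x + (p - 1) + letterVal y) + C →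
      [x] ++ w ++ [y] ∈ St := by
    intro A B C hC hB hBC hk hl hr
    refine isBalanced_of_line _ A B C hC fun k hkl => ?_
    have hkl : k ≤ n + 2 := by simpa [h.length_eq] using hkl
    rcases k with _ | k
    · simpa using ⟨hB, hBC⟩
    rcases Nat.lt_or_ge n k with hkn | hkn
    · obtain rfl : k = n + 1 := by omega
      rw [height_cons_concat_length h.length_eq, hend]
      push_cast
      constructor <;> linarith
    · rw [height_cons_concat_succ h.length_eq x y hkn]
      push_cast
      exact hk k hkn
  have haux : ∀ k : ℕ, k ≤ n →
      ((n : ℤ) + 2) ^ 2 * height w k + (n + 2) ≤ (n + 2) * ((k + 1) * p) ∧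
      (n + 2) * ((k + 1) * p) + (n + 2) ≤ ((n : ℤ) + 2) ^ 2 * height w k + (n + 2) ^ 2 := by
    intro k hk
    have h1 := mul_le_mul_of_nonneg_left (hstrict k hk).1 hN.le
    have h2 := mul_le_mul_of_nonneg_left (hstrict k hk).2 hN.le
    constructor <;> linarith
  cases x <;> cases y
  · refine line ((n + 2) * p - 1) 0 ((n + 2) ^ 2) hN2 le_rfl hN2 (fun k hk => ?_) ?_ ?_
    · obtain ⟨h1, h2⟩ := haux k hk
      have : (k : ℤ) ≤ n := by exact_mod_cast hk
      simp only [letterVal_a]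
      constructor <;> linarith
    · simp only [letterVal_a]; nlinarith
    · simp only [letterVal_a]; nlinarith
  · refine line p 0 (n + 2) hN le_rfl hN (fun k hk => ?_) ?_ ?_
    · obtain ⟨h1, h2⟩ := hstrict k hk
      simp only [letterVal_a]
      constructor <;> linarith
    · simp only [letterVal_a, letterVal_b]; linarith
    · simp only [letterVal_a, letterVal_b]; linarith
  · refine line p (n + 1) (n + 2) hN (by positivity) (by linarith) (fun k hk => ?_) ?_ ?_
    · obtain ⟨h1, h2⟩ := hstrict k hk
      simp only [letterVal_b]
      constructor <;> linarith
    · simp only [letterVal_a, letterVal_b]; linarith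
    · simp only [letterVal_a, letterVal_b]; linarith
  · refine line ((n + 2) * p + 1) ((n + 2) ^ 2 - 1) ((n + 2) ^ 2) hN2 (by linarith)
      (by linarith) (fun k hk => ?_) ?_ ?_
    · obtain ⟨h1, h2⟩ := haux k hk
      have : (k : ℤ) ≤ n := by exact_mod_cast hk
      simp only [letterVal_b]
      constructor <;> linarith
    · simp only [letterVal_b]; nlinarith
    · simp only [letterVal_b]; nlinarith

/-- The height of a word following a line, at a point of the line with integer coordinates. -/
theorem IsLineWord.height_of_mul_eq {n : ℕ} {p s : ℤ} {w : Word} (h : IsLineWord n p s w)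
    (hs : s = 0 ∨ s = 1) {k : ℕ} (hk : k ≤ n) {q : ℤ} (hq : ((n : ℤ) + 2) * q = (k + 1) * p) :
    height w k = q - s := by
  have hN : (0 : ℤ) ≤ (n : ℤ) + 2 := by positivity
  have h1 := h.le k hk
  have h2 := h.lt k hk
  have e1 : ((n : ℤ) + 2) * height w k < ((n : ℤ) + 2) * (q - s + 1) := by
    rcases hs with rfl | rfl <;> linarith
  have e2 : ((n : ℤ) + 2) * (q - s) < ((n : ℤ) + 2) * (height w k + 1) := by
    rcases hs with rfl | rfl <;> linarith
  have f1 := lt_of_mul_lt_mul_left e1 hN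
  have f2 := lt_of_mul_lt_mul_left e2 hN
  omega

/-- With d = gcd(n + 2, p), the point at abscissa (n + 2)/d is an interior lattice point; j + 1 is
the abscissa of its mirror image. -/
theorem exists_mul_eq_of_not_coprime {n p : ℕ} (hco : ¬ Nat.Coprime (n + 2) p) :
    ∃ k j q : ℕ, k + j = n ∧ ((n : ℤ) + 2) * q = (k + 1) * p := by
  set d := Nat.gcd (n + 2) p with hd
  obtain ⟨m, hm⟩ : d ∣ n + 2 := Nat.gcd_dvd_left _ _
  obtain ⟨q, hq⟩ : d ∣ p := Nat.gcd_dvd_right _ _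
  have hd0 : d ≠ 0 := by rintro h0; simp [h0] at hm
  have hd1 : d ≠ 1 := hco
  have hm0 : m ≠ 0 := by rintro rfl; simp at hm
  have hmn : m + m ≤ n + 2 := by
    rw [hm]
    nlinarith [show 2 ≤ d by omega]
  refine ⟨m - 1, n - (m - 1), q, by omega, ?_⟩
  have : ((m - 1 : ℕ) : ℤ) + 1 = m := by omega
  rw [this]
  have hm' : (n : ℤ) + 2 = d * m := by exact_mod_cast hm
  rw [hm', hq]
  push_cast
  ring

theorem IsLineWord.not_mem_SBS {n p : ℕ} {s : ℤ} {w : Word} (h : IsLineWord n p s w)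
    (hp : 1 ≤ p) (hpn : p ≤ n + 1) (hs : s = 0 ∨ s = 1) (hco : ¬ Nat.Coprime (n + 2) p) :
    w ∉ SBS := by
  intro hw
  obtain ⟨k, j, q, hkj, hq⟩ := exists_mul_eq_of_not_coprime hco
  have hend : height w n = p - 1 :=
    h.height_length (by omega) (by omega) (by omega) (by omega)
  have hk := h.height_of_mul_eq hs (k := k) (by omega) hq
  have hj := h.height_of_mul_eq hs (k := j) (q := p - q) (by omega) (by
    have : (n : ℤ) = k + j := by exact_mod_cast hkj.symm
    rw [mul_sub, hq, this]
    ring)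
  -- The prefix and suffix of length k + 1 of xwy are compared: `bwa` fails for s = 0 and `awb` for
  -- s = 1.
  have key : ∀ x y : Letter,
      |letterVal x + height w k - (letterVal y + height w n - height w j)| ≤ 1 := by
    intro x y
    have hb := (isBalanced_iff_height _).1 (hw.2 x y) 0 (j + 1) (k + 1)
      (by simp [h.length_eq]; omega) (by simp [h.length_eq]; omega)
    have e : j + 1 + (k + 1) = n + 2 := by omega
    rw [zero_add, e, height_cons_concat_length h.length_eq, height_zero,
      height_cons_concat_succ h.length_eq x y (by omega),
      height_cons_concat_succ h.length_eq x y (by omega)] at hb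
    refine le_trans (le_of_eq ?_) hb
    congr 1
    ring
  have k1 := key Letter.b Letter.a
  have k2 := key Letter.a Letter.b
  simp only [letterVal_a, letterVal_b, abs_le] at k1 k2
  omega

/-! ### Bispecial words are line words. -/

/-- A superadditive sequence with `G (i + k) ≤ G i + G k + 1` lying between two parallel lines at
vertical distance `1` cannot touch both of them. -/
theorem not_touch_both {N p : ℤ} (G : ℕ → ℤ) (M : ℕ)
    (hsup : ∀ i k, 1 ≤ i → 1 ≤ k → i + k ≤ M → G i + G k ≤ G (i + k))
    (hsub : ∀ i k, 1 ≤ i → 1 ≤ k → i + k ≤ M → G (i + k) ≤ G i + G k + 1)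
    (hN : 0 < N) (hle : ∀ k : ℕ, 1 ≤ k → k ≤ M → N * G k ≤ k * p)
    (hge : ∀ k : ℕ, 1 ≤ k → k ≤ M → k * p ≤ N * G k + N) :
    ∀ t e f : ℕ, e + f ≤ t → 1 ≤ e → e ≤ M → 1 ≤ f → f ≤ M → N * G e = e * p →
      f * p = N * G f + N → False := by
  intro t
  induction t with
  | zero => intros; omega
  | succ t ih =>
    intro e f hef he heM hf hfM hE hF
    -- Subtractive Euclid: the difference of the two contact abscissas is again a contact, on the
    -- same edge as the larger one. Equal abscissas are absurd since N > 0.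
    rcases lt_trichotomy e f with hlt | rfl | hlt
    · obtain ⟨r, rfl⟩ := Nat.exists_eq_add_of_lt hlt
      rw [add_assoc] at *
      refine ih e (r + 1) (by omega) he heM (by omega) (by omega) hE ?_
      have h1 := hge (r + 1) (by omega) (by omega)
      have h2 := mul_le_mul_of_nonneg_left (hsup e (r + 1) he (by omega) hfM) hN.le
      push_cast at *
      linarith
    · linarith
    · obtain ⟨r, rfl⟩ := Nat.exists_eq_add_of_lt hlt
      rw [add_assoc] at *
      refine ih (r + 1) f (by omega) (by omega) (by omega) hf hfM ?_ hF
      have h1 := hle (r + 1) (by omega) (by omega)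
      have h2 := mul_le_mul_of_nonneg_left (hsub f (r + 1) hf (by omega) heM) hN.le
      push_cast at *
      linarith

/-- If `G` is superadditive modulo `N`, where it gains `p` along a period, then it lies below the
line of slope `p / N`. -/
theorem mul_le_of_superadditive_mod {N : ℕ} {p : ℤ} (G : ℕ → ℤ) (h0 : G 0 = 0) (k : ℕ)
    (hkN : k < N) (h1 : ∀ i, i + k < N → G i + G k ≤ G (i + k))
    (h2 : ∀ i, i < N → N ≤ i + k → G i + G k ≤ G (i + k - N) + p) :
    (N : ℤ) * G k ≤ k * p := by
  have hN : 0 < N := by omega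
  -- This is superadditivity of the quasi-periodic extension of G, which gains p over each period N.
  have step : ∀ i : ℕ, (i / N : ℕ) * p + G (i % N) + G k ≤
      ((i + k) / N : ℕ) * p + G ((i + k) % N) := by
    intro i
    have hlt : i % N < N := Nat.mod_lt _ hN
    have hi : i + k = (i % N + k) + N * (i / N) := by
      have := Nat.mod_add_div i N
      omega
    rw [hi, Nat.add_mul_div_left _ _ hN, Nat.add_mul_mod_self_left]
    generalize i % N = r at hlt ⊢
    generalize i / N = d
    rcases Nat.lt_or_ge (r + k) N with hc | hc
    · rw [Nat.div_eq_of_lt hc, Nat.mod_eq_of_lt hc, zero_add]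
      linarith [h1 _ hc]
    · have := h2 _ hlt hc
      have hdiv : (r + k) / N = 1 := by
        rw [Nat.div_eq_sub_div hN hc, Nat.div_eq_of_lt (by omega)]
      rw [hdiv, Nat.mod_eq_sub_mod hc, Nat.mod_eq_of_lt (by omega)]
      push_cast
      linarith
  have iter : ∀ m : ℕ, (m : ℤ) * G k ≤ (m * k / N : ℕ) * p + G (m * k % N) := by
    intro m
    induction m with
    | zero => simp [h0]
    | succ m ih =>
      have := step (m * k)
      rw [Nat.succ_mul]
      push_cast at *
      linarith
  have := iter N
  rwa [Nat.mul_div_cancel_left _ hN, Nat.mul_mod_right, h0, add_zero] at this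

theorem exists_isLineWord_of_mem_BS {n : ℕ} {w : Word} (hn : w.length = n) (hw : w ∈ BS) :
    IsLineWord n (height w n + 1) 0 w ∨ IsLineWord n (height w n + 1) 1 w := by
  obtain ⟨⟨hbal, hla, hlb⟩, ⟨-, hra, hrb⟩⟩ := hw
  set p : ℤ := height w n + 1 with hp
  have hN : (0 : ℤ) < (n : ℤ) + 2 := by positivity
  -- A factor of w of length k + 1 is compared with the prefixes of that length of `aw` and `bw`,
  -- which differ by one in height.
  have left : ∀ j k : ℕ, j + (k + 1) ≤ n →
      height w k ≤ height w (j + (k + 1)) - height w j ∧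
        height w (j + (k + 1)) - height w j ≤ height w k + 1 := by
    intro j k hjk
    have key : ∀ x, IsBalanced (x :: w) →
        |letterVal x + height w k - (height w (j + (k + 1)) - height w j)| ≤ 1 := by
      intro x hx
      have hb := (isBalanced_iff_height _).1 hx 0 (j + 1) (k + 1)
        (by simp; omega) (by simp; omega)
      have e : j + 1 + (k + 1) = j + (k + 1) + 1 := by omega
      rw [zero_add, e, height_zero, height_cons_succ, height_cons_succ, height_cons_succ] at hb
      refine le_trans (le_of_eq ?_) hb
      congr 1
      ring
    have k1 := key _ hla
    have k2 := key _ hlb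
    simp only [letterVal_a, letterVal_b, abs_le] at k1 k2
    omega
  have right : ∀ j k l : ℕ, j + (k + 1) ≤ n → k + l = n →
      height w n - height w l ≤ height w (j + (k + 1)) - height w j ∧
        height w (j + (k + 1)) - height w j ≤ height w n - height w l + 1 := by
    intro j k l hjk hkl
    have key : ∀ x, IsBalanced (w ++ [x]) →
        |letterVal x + height w n - height w l - (height w (j + (k + 1)) - height w j)| ≤ 1 := by
      intro x hx
      have hb := (isBalanced_iff_height _).1 hx l j (k + 1)
        (by simp; omega) (by simp; omega)
      have e : l + (k + 1) = w.length + 1 := by omega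
      rw [e, height_concat_length, height_append_of_le _ _ (by omega),
        height_append_of_le _ _ (by omega), height_append_of_le _ _ (by omega), hn] at hb
      refine le_trans (le_of_eq ?_) hb
      congr 1
      ring
    have k1 := key _ hra
    have k2 := key _ hrb
    simp only [letterVal_a, letterVal_b, abs_le] at k1 k2
    omega
  have cross : ∀ k l : ℕ, k + l = n → height w n - 1 ≤ height w k + height w l ∧
      height w k + height w l ≤ height w n + 1 := by
    intro k l hkl
    rcases Nat.eq_zero_or_pos l with rfl | hl
    · obtain rfl : k = n := by omega
      rw [height_zero]
      omega
    · have h1 := left 0 k (by omega)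
      have h2 := right 0 k l (by omega) hkl
      omega
  have lower : ∀ k : ℕ, k ≤ n → ((n : ℤ) + 2) * height w k ≤ (k + 1) * p := by
    intro k hk
    -- Truncated subtraction supplies G(0) = 0. Sums below N use `left`, those beyond N use `right`,
    -- and a sum equal to N uses `cross`.
    have := mul_le_of_superadditive_mod (N := n + 2) (p := p) (fun i => height w (i - 1))
      (by simp) (k + 1) (by omega) (fun i hi => ?_) (fun i hi hik => ?_)
    · simpa using this
    · rcases i with _ | i
      · simp
      · have := left i k (by omega)
        simp only [Nat.add_sub_cancel]
        rw [show i + 1 + (k + 1) - 1 = i + (k + 1) by omega]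
        linarith
    · rcases i with _ | i
      · omega
      obtain ⟨l, hl⟩ : ∃ l, k + l = n := ⟨n - k, by omega⟩
      rcases Nat.lt_or_ge l i with hc | hc
      · obtain ⟨m, rfl⟩ := Nat.exists_eq_add_of_lt hc
        have := right m l k (by omega) (by omega)
        simp only [Nat.add_sub_cancel]
        rw [show l + m + 1 + 1 + (k + 1) - (n + 2) - 1 = m by omega,
          show l + m + 1 = m + (l + 1) by omega]
        linarith
      · obtain rfl : i = l := by omega
        have := cross k i hl
        simp only [Nat.add_sub_cancel]
        rw [show i + 1 + (k + 1) - (n + 2) - 1 = 0 by omega, height_zero]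
        linarith
  have upper : ∀ k : ℕ, k ≤ n → (k + 1) * p ≤ ((n : ℤ) + 2) * height w k + (n + 2) := by
    intro k hk
    have := mul_le_of_superadditive_mod (N := n + 2) (p := -p)
      -- The value at 0 must be set apart, since the formula would give -1 there.
      (fun i => if i = 0 then 0 else - height w (i - 1) - 1)
      (by simp) (k + 1) (by omega) (fun i hi => ?_) (fun i hi hik => ?_)
    · simp at this
      linarith
    · rcases i with _ | i
      · simp
      · have := left i k (by omega)
        simp only [Nat.add_sub_cancel, Nat.add_eq_zero_iff, one_ne_zero, and_false, if_false]
        rw [show i + 1 + (k + 1) - 1 = i + (k + 1) by omega]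
        linarith
    · rcases i with _ | i
      · omega
      obtain ⟨l, hl⟩ : ∃ l, k + l = n := ⟨n - k, by omega⟩
      rcases Nat.lt_or_ge l i with hc | hc
      · obtain ⟨m, rfl⟩ := Nat.exists_eq_add_of_lt hc
        have := right m l k (by omega) (by omega)
        rw [show l + m + 1 + 1 + (k + 1) - (n + 2) = m + 1 by omega]
        simp only [Nat.add_sub_cancel, Nat.add_eq_zero_iff, one_ne_zero, and_false, if_false]
        rw [show l + m + 1 = m + (l + 1) by omega]
        linarith
      · obtain rfl : i = l := by omega
        have := cross k i hl
        rw [show i + 1 + (k + 1) - (n + 2) = 0 by omega]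
        simp only [Nat.add_sub_cancel, Nat.add_eq_zero_iff, one_ne_zero, and_false, if_false,
          if_true]
        linarith
  -- Contact with the lower edge of the strip forces s = 1, the upper edge then being excluded;
  -- without such contact s = 0.
  by_cases hF : ∃ f : ℕ, f ≤ n ∧ ((f : ℤ) + 1) * p = ((n : ℤ) + 2) * height w f + (n + 2)
  · right
    obtain ⟨f, hfn, hf⟩ := hF
    refine ⟨hn, fun k hk => ?_, fun k hk => by linarith [upper k hk]⟩
    refine Int.le_sub_one_of_lt (lt_of_le_of_ne (lower k hk) fun hE => ?_)
    refine not_touch_both (N := n + 2) (p := p) (fun i => height w (i - 1)) (n + 1)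
      ?_ ?_ hN ?_ ?_ _ (k + 1) (f + 1) le_rfl (by omega) (by omega) (by omega) (by omega)
      (by push_cast; simpa using hE) (by push_cast; simpa using hf)
    · rintro (_ | i) (_ | k) hi hk hik
      · omega
      · omega
      · omega
      have := left i k (by omega)
      simp only [Nat.add_sub_cancel]
      rw [show i + 1 + (k + 1) - 1 = i + (k + 1) by omega]
      linarith
    · rintro (_ | i) (_ | k) hi hk hik
      · omega
      · omega
      · omega
      have := left i k (by omega)
      simp only [Nat.add_sub_cancel]
      rw [show i + 1 + (k + 1) - 1 = i + (k + 1) by omega]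
      linarith
    · rintro (_ | k) hk hkn
      · omega
      · simpa using lower k (by omega)
    · rintro (_ | k) hk hkn
      · omega
      · simpa using upper k (by omega)
  · left
    push Not at hF
    refine ⟨hn, fun k hk => by linarith [lower k hk], fun k hk => ?_⟩
    rw [sub_zero]
    exact lt_of_le_of_ne (upper k hk) (hF k hk)

/-! ### Counting. -/

theorem NBS_inter_length (n : ℕ) :
    NBS ∩ {w | w.length = n} =
      (fun x : ℕ × ℤ => lineWord n x.1 x.2) ''
        (((Finset.range (n + 2)).filter fun p => 1 ≤ p ∧ ¬ Nat.Coprime (n + 2) p) ×ˢ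
          ({0, 1} : Finset ℤ) : Finset (ℕ × ℤ)) := by
  ext w
  simp only [Set.mem_inter_iff, Set.mem_ofPred_eq, Set.mem_image, Finset.mem_coe,
    Finset.mem_product, Finset.mem_filter, Finset.mem_range, Finset.mem_insert,
    Finset.mem_singleton, Prod.exists]
  constructor
  · rintro ⟨⟨hbs, hsbs⟩, hn⟩
    have h0 := height_nonneg w n
    have h1 := height_le w n
    obtain ⟨p, hp⟩ : ∃ p : ℕ, height w n + 1 = p := ⟨(height w n + 1).toNat, by omega⟩
    obtain ⟨s, hs, h⟩ : ∃ s : ℤ, (s = 0 ∨ s = 1) ∧ IsLineWord n p s w := by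
      rcases exists_isLineWord_of_mem_BS hn hbs with h | h
      · exact ⟨0, Or.inl rfl, hp ▸ h⟩
      · exact ⟨1, Or.inr rfl, hp ▸ h⟩
    refine ⟨p, s, ⟨⟨by omega, by omega, fun hco => hsbs ?_⟩, hs⟩, ?_⟩
    · refine h.mem_SBS (by omega) (by omega) hs ?_
      exact_mod_cast (Nat.isCoprime_iff_coprime.2 hco).symm
    · exact (isLineWord_lineWord n (by omega) (by omega) (by omega) (by omega)).eq h
  · rintro ⟨p, s, ⟨⟨hp2, hp1, hco⟩, hs⟩, rfl⟩
    have h := isLineWord_lineWord n (p := p) (s := s)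
      (by omega) (by omega) (by omega) (by omega)
    exact ⟨⟨h.mem_BS (by omega) (by omega) hs,
      h.not_mem_SBS (by omega) (by omega) hs hco⟩, h.length_eq⟩

/-- The total height recovers p, and the height q - s at an interior lattice point recovers s. -/
theorem lineWord_injOn (n : ℕ) :
    Set.InjOn (fun x : ℕ × ℤ => lineWord n x.1 x.2)
      (((Finset.range (n + 2)).filter fun p => 1 ≤ p ∧ ¬ Nat.Coprime (n + 2) p) ×ˢ
          ({0, 1} : Finset ℤ) : Finset (ℕ × ℤ)) := by
  rintro ⟨p, s⟩ hx ⟨p', s'⟩ hy heq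
  simp only [Finset.mem_coe, Finset.mem_product, Finset.mem_filter, Finset.mem_range,
    Finset.mem_insert, Finset.mem_singleton] at hx hy
  obtain ⟨⟨hp2, hp1, hco⟩, hs⟩ := hx
  obtain ⟨⟨hp2', hp1', -⟩, hs'⟩ := hy
  have h := isLineWord_lineWord n (p := p) (s := s)
    (by omega) (by omega) (by omega) (by omega)
  have h' := isLineWord_lineWord n (p := p') (s := s')
    (by omega) (by omega) (by omega) (by omega)
  simp only at heq
  rw [← heq] at h'
  have e := h.height_length (by omega) (by omega) (by omega) (by omega)
  have e' := h'.height_length (by omega) (by omega) (by omega) (by omega)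
  obtain rfl : p = p' := by omega
  obtain ⟨k, j, q, hkj, hq⟩ := exists_mul_eq_of_not_coprime hco
  have f := h.height_of_mul_eq hs (k := k) (by omega) hq
  have f' := h'.height_of_mul_eq hs' (k := k) (by omega) hq
  rw [Prod.mk.injEq]
  exact ⟨rfl, by omega⟩

theorem card_not_coprime (n : ℕ) :
    ((Finset.range (n + 2)).filter fun p => 1 ≤ p ∧ ¬ Nat.Coprime (n + 2) p).card +
      Nat.totient (n + 2) = n + 1 := by
  have h1 := Finset.card_filter_add_card_filter_not (s := Finset.range (n + 2))
    (fun p => Nat.Coprime (n + 2) p)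
  rw [Finset.card_range] at h1
  -- The residue 0 is never coprime to n + 2 ≥ 2, and it is the only one excluded by 1 ≤ p.
  have h2 : ((Finset.range (n + 2)).filter fun p => ¬ Nat.Coprime (n + 2) p) =
      insert 0 ((Finset.range (n + 2)).filter fun p => 1 ≤ p ∧ ¬ Nat.Coprime (n + 2) p) := by
    ext p
    rcases p with _ | p <;> simp
  rw [h2, Finset.card_insert_of_notMem (by simp)] at h1
  rw [Nat.totient]
  omega

end Word

theorem mainTheorem3 (n : ℕ) (hn : 1 < n) :
    (Word.numOfLength Word.NBS n : ℤ) =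
      2 * ((n : ℤ) + 1 - (Nat.totient (n + 2) : ℤ)) := by
  have hcard := Word.card_not_coprime n
  rw [Word.numOfLength, Word.NBS_inter_length, (Word.lineWord_injOn n).ncard_image,
    Set.ncard_coe_finset, Finset.card_product,
    Finset.card_pair (show (0 : ℤ) ≠ 1 by norm_num)]
  push_cast
  omega
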